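/- Let $\mathcal X$ be a measurable space and $k\ge 1$. A labeled bag is a tuple $((x_1,y_1),\dots,(x_k,y_k))\in(\mathcal X\times\{0,1\})^k$ with law $Q$ (any probability measure); only the instances $x=(x_1,\dots,x_k)$ and the label proportion $\tilde y=\frac1k\sum_j y_j$ are observed. Let $F$ be a class of measurable classifiers $f:\mathcal X\to[0,1]$ that is pointwise separable (some countable $F_0\subseteq F$ is such that every $f\in F$ is the pointwise limit of a sequence in $F_0$). For $f\in F$ write $$p_f(s\mid x)=\sum_{\hat y\in\{0,1\}^k,\ \sum_j\hat y_j=s}\ \prod_{j=1}^k f(x_j)^{\hat y_j}(1-f(x_j))^{1-\hat y_j}$$ for the count probability, and let $\ell$ be either the count loss $\ell=-\log p_f(k\tilde y\mid x)$ (with value $+\infty$ if the probability is $0$) or its likelihood form $\ell=-p_f(k\tilde y\mid x)$. Assume that, on the prediction vectors $(f(x_1),\dots,f(x_k))$ produced by classifiers $f\in F$ and for every $y\in\{0,1\}^k$, the loss is $\rho$-Lipschitz in the prediction vector (Euclidean norm) and takes values in $[-M,M]$. Let $$R_{llp}(f)=\tfrac1{k(k+1)}\,\mathbb E_Q[\ell],\qquad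 \hat R_m(f)=\tfrac1{k(k+1)}\cdot\tfrac1m\sum_{i=1}^m \ell_i(f),$$ where $\ell_i(f)$ is the loss of $f$ on the $i$-th of the bags $B_1,B_2,\dots$, which are i.i.d. with law $Q$. Let $f_{llp,m}\in F$ be a minimizer of $\hat R_m$ over $F$ and $f^*_{llp}\in F$ a minimizer of $R_{llp}$ over $F$. Let $\nu_j$ be the law of $x_j$ and let $$\mathfrak R_m(F,\nu)=\mathbb E_{x_1,\dots,x_m\sim\nu\ \text{i.i.d.}}\ \mathbb E_\sigma\ \sup_{f\in F}\frac1m\sum_{i=1}^m\sigma_i f(x_i)$$ ($\sigma$ uniform on $\{-1,1\}^m$) be the Rademacher complexity. Then: 1. For all $m\ge1$ and $\delta\in(0,1)$, with probability at least $1-\delta$, $$R_{llp}(f_{llp,m})-R_{llp}(f^*_{llp})\le\frac1{k(k+1)}\Big(4\sqrt2\,\rho\sum_{j=1}^k\mathfrak R_m(F,\nu_j)+4M\sqrt{\tfrac{\log(2/\delta)}{2m}}\Big).$$ 2. If $\mathfrak R_m(F,\nu_j)\to0$ as $m\to\infty$ for every $j$, then the empirical risk minimizer converges to the true risk minimizer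 in the sense of the risk: almost surely $R_{llp}(f_{llp,m})\to R_{llp}(f^*_{llp})$ as $m\to\infty$. 3. If $\mathfrak R_m(F,\nu_j)\le C/\sqrt m$ for all $m\ge 1$ and all $j$, the convergence is at rate $1/\sqrt m$: for all $m\ge1$ and $\delta\in(0,1)$, with probability at least $1-\delta$, $$R_{llp}(f_{llp,m})-R_{llp}(f^*_{llp})\le\frac1{k(k+1)}\cdot\frac{4\sqrt2\,\rho\,k\,C+4M\sqrt{\log(2/\delta)/2}}{\sqrt m}.$$ -/

import Mathlib

open MeasureTheory ProbabilityTheory Filter Topology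

namespace CountLLP

noncomputable section

/-- The count probability `p(∑ ŷ_i = s)` of `k` independent binary prediction variables
with `p(ŷ_i = 1) = v i`. -/
def countProb {k : ℕ} (v : Fin k → ℝ) (s : ℝ) : ℝ :=
  ∑ y : Fin k → Fin 2,
    if ∑ i, ((y i : ℕ) : ℝ) = s then ∏ i, (if y i = 1 then v i else 1 - v i) else 0

/-- A bag loss: the arguments are the vector of predictions `(f x_1, …, f x_k)` on the bag and
the label proportion of the bag. Losses may take infinite values. -/
abbrev BagLoss (k : ℕ) : Type := (Fin k → ℝ) → ℝ → EReal

/-- The count loss `- log p(∑ ŷ_i = k ỹ)`, equal to `+∞` when the probability is zero. -/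
def countLoss (k : ℕ) : BagLoss k := fun v r =>
  - ENNReal.log (ENNReal.ofReal (countProb v (k * r)))

/-- The likelihood form `- p(∑ ŷ_i = k ỹ)` of the count loss. -/
def countLikelihoodLoss (k : ℕ) : BagLoss k := fun v r =>
  ((- countProb v (k * r) : ℝ) : EReal)

/-- A bag of `k` instances with their (hidden) binary labels. -/
abbrev LabeledBag (k : ℕ) (X : Type*) : Type _ := Fin k → X × Fin 2

/-- The label proportion `ỹ = (∑ y_j) / k`. -/
def labelProportion {k : ℕ} (y : Fin k → Fin 2) : ℝ := (∑ j, ((y j : ℕ) : ℝ)) / k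

/-- The loss that a classifier incurs on a bag; the labels enter only through their proportion. -/
def lossOnBag {k : ℕ} {X : Type*} (l : BagLoss k) (f : X → ℝ) (b : LabeledBag k X) : ℝ :=
  (l (fun j => f (b j).1) (labelProportion fun j => (b j).2)).toReal

/-- The true risk of a classifier under the law `Q` of a labeled bag. -/
def risk {k : ℕ} {X : Type*} [MeasurableSpace X] (l : BagLoss k) (Q : Measure (LabeledBag k X))
    (f : X → ℝ) : ℝ :=
  1 / ((k : ℝ) * (k + 1)) * ∫ b, lossOnBag l f b ∂Q

/-- The empirical risk of a classifier on the first `m` bags of a sequence. -/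
def empiricalRisk {k : ℕ} {X : Type*} (l : BagLoss k) (m : ℕ) (B : ℕ → LabeledBag k X)
    (f : X → ℝ) : ℝ :=
  1 / ((k : ℝ) * (k + 1)) * (1 / (m : ℝ) * ∑ i ∈ Finset.range m, lossOnBag l f (B i))

/-- The vectors of predictions that the classifiers of `F` produce on bags of size `k`. -/
def predictionVectors (k : ℕ) {X : Type*} (F : Set (X → ℝ)) : Set (Fin k → ℝ) :=
  {v | ∃ f ∈ F, ∃ x : Fin k → X, v = fun j => f (x j)}

/-- For all labels, the loss lies in `[-M, M]` on the predictions of the classifiers of `F`;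
in particular it is finite there. -/
def LossBounded {k : ℕ} {X : Type*} (l : BagLoss k) (F : Set (X → ℝ)) (M : ℝ) : Prop :=
  ∀ y : Fin k → Fin 2, ∀ v ∈ predictionVectors k F,
    ((-M : ℝ) : EReal) ≤ l v (labelProportion y) ∧ l v (labelProportion y) ≤ (M : EReal)

/-- For all labels, the loss is `ρ`-Lipschitz, for the Euclidean norm, in the vector of
predictions, on the predictions of the classifiers of `F`. -/
def LossLipschitz {k : ℕ} {X : Type*} (l : BagLoss k) (F : Set (X → ℝ)) (ρ : ℝ) : Prop :=
  ∀ y : Fin k → Fin 2, ∀ u ∈ predictionVectors k F, ∀ v ∈ predictionVectors k F,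
    |(l u (labelProportion y)).toReal - (l v (labelProportion y)).toReal|
      ≤ ρ * √(∑ j, (u j - v j) ^ 2)

/-- A classifier of `F` that minimizes `R` over `F`. -/
def IsMinimizer {X : Type*} (R : (X → ℝ) → ℝ) (F : Set (X → ℝ)) (f : X → ℝ) : Prop :=
  f ∈ F ∧ ∀ g ∈ F, R f ≤ R g

/-- The measurability condition on `F`: some countable subclass reaches every member of `F` as
a pointwise limit of a sequence. -/
def PointwiseSeparable {X : Type*} (F : Set (X → ℝ)) : Prop :=
  ∃ F₀ ⊆ F, F₀.Countable ∧
    ∀ f ∈ F, ∃ u : ℕ → X → ℝ, (∀ n, u n ∈ F₀) ∧ ∀ x, Tendsto (fun n => u n x) atTop (𝓝 (f x))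

/-- The empirical Rademacher complexity of `F` on the points `x_1, …, x_m`: the average, over
all sign vectors, of `sup_{f ∈ F} (1/m) ∑ σ_i f(x_i)`. -/
def empiricalRademacher {X : Type*} (F : Set (X → ℝ)) {m : ℕ} (x : Fin m → X) : ℝ :=
  1 / (2 : ℝ) ^ m * ∑ σ : Fin m → ℤˣ,
    ⨆ f : F, 1 / (m : ℝ) * ∑ i, ((σ i : ℤ) : ℝ) * (f : X → ℝ) (x i)

/-- The Rademacher complexity of `F` for `m` independent points with law `ν`. -/
def rademacher {X : Type*} [MeasurableSpace X] (F : Set (X → ℝ)) (ν : Measure X) (m : ℕ) : ℝ :=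
  ∫ x, empiricalRademacher F x ∂(Measure.pi fun _ : Fin m => ν)

/-- The law of the `j`-th instance of a bag with law `Q`. -/
def instanceLaw {k : ℕ} {X : Type*} [MeasurableSpace X] (Q : Measure (LabeledBag k X))
    (j : Fin k) : Measure X :=
  Q.map fun b => (b j).1

end

end CountLLP

namespace CountLLP

noncomputable section

open scoped BigOperators NNReal

/-! ### Averages over signs -/

/-! Call the true minus the empirical mean loss of a classifier its deviation. The empirical
minimizer does no worse on the sample than a fixed `f₀` in `F`, so up to the factor `1/(k(k+1))` its
excess risk is at most the supremum of the deviations over `F`, minus the deviation of `f₀`. The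
deviation of `f₀` has mean zero, so the mean of this random variable is that of the supremum alone.
Symmetrization (`integral_iSup_deviation_le`) bounds it by twice the Rademacher complexity of the
loss class, and vector contraction (`vector_contraction_sum`) passes from the losses to the
classifiers at the cost of a factor `9/5 * ρ`. Replacing one bag moves the random variable by at
most `4M/m`, so McDiarmid's inequality controls its upper tail.

The contraction rests on Khintchine's inequality: a Euclidean norm is dominated by the mean absolute
value of a random signed sum, which is linear in the predictions. The sharp constant `√2` is not
needed: the one-sided comparison gives the factor `2 * 9/5 = 18/5`, which is below `4√2`.

Measurability of the suprema comes from the countable class `F₀`; the functionals involved are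
continuous along pointwise limits, so nothing is lost. Almost sure convergence follows from
Borel–Cantelli with confidence levels `1/(m+1)²`, and the rate by substitution. -/

lemma expect_intUnits (g : ℤˣ → ℝ) : 𝔼 e, g e = (g 1 + g (-1)) / 2 := by
  rw [Fintype.expect_eq_sum_div_card, UnitsInt.univ]
  simp

lemma expect_neg_signs {ι : Type*} [Fintype ι] [DecidableEq ι] (g : (ι → ℤˣ) → ℝ) :
    𝔼 ε, g (-ε) = 𝔼 ε, g ε :=
  Fintype.expect_equiv (Equiv.neg _) _ _ fun _ => rfl

lemma expect_fin_cons {α : Type*} [Fintype α] {n : ℕ} (g : (Fin (n + 1) → α) → ℝ) :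
    𝔼 ε, g ε = 𝔼 e, 𝔼 ε, g (Fin.cons e ε) := by
  rw [← Finset.expect_product' Finset.univ Finset.univ fun e ε => g (Fin.cons e ε),
    Finset.univ_product_univ]
  exact (Fintype.expect_equiv (Fin.consEquiv fun _ => α) _ _ fun _ => rfl).symm

/-- Each coordinate of a uniformly random function is uniformly distributed. -/
lemma expect_eval {ι α : Type*} [Fintype ι] [DecidableEq ι] [Fintype α] [Nonempty α] (j : ι)
    (g : α → ℝ) : 𝔼 ε : ι → α, g (ε j) = 𝔼 e, g e := by
  rw [Fintype.expect_equiv (Equiv.funSplitAt j α) (fun ε => g (ε j)) (fun p => g p.1)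
      fun _ => rfl, ← Finset.univ_product_univ,
    Finset.expect_product' Finset.univ Finset.univ fun e _ => g e]
  simp

lemma expect_sign_sum_sq {k : ℕ} (w : Fin k → ℝ) :
    𝔼 ε : Fin k → ℤˣ, (∑ j, ((ε j : ℤ) : ℝ) * w j) ^ 2 = ∑ j, w j ^ 2 := by
  induction k with
  | zero => simp
  | succ n ih =>
    have h : ∀ ε : Fin n → ℤˣ, ((1 * w 0 + ∑ j, ((ε j : ℤ) : ℝ) * w j.succ) ^ 2 +
        (-1 * w 0 + ∑ j, ((ε j : ℤ) : ℝ) * w j.succ) ^ 2) / 2 =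
        w 0 ^ 2 + (∑ j, ((ε j : ℤ) : ℝ) * w j.succ) ^ 2 := fun ε => by ring
    rw [expect_fin_cons, Finset.expect_comm]
    simp only [Fin.sum_univ_succ, Fin.cons_zero, Fin.cons_succ, expect_intUnits]
    push_cast
    simp only [h, Finset.expect_add_distrib, ih, Fintype.expect_const]

/-- Averaging over one sign kills the odd powers. The remaining cross term `6 w₀² ∑ wⱼ²` is exactly
that of `3 (w₀² + ∑ wⱼ²)²`. -/
lemma expect_sign_sum_pow_four {k : ℕ} (w : Fin k → ℝ) :
    𝔼 ε : Fin k → ℤˣ, (∑ j, ((ε j : ℤ) : ℝ) * w j) ^ 4 ≤ 3 * (∑ j, w j ^ 2) ^ 2 := by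
  induction k with
  | zero => simp
  | succ n ih =>
    have h : ∀ ε : Fin n → ℤˣ, ((1 * w 0 + ∑ j, ((ε j : ℤ) : ℝ) * w j.succ) ^ 4 +
        (-1 * w 0 + ∑ j, ((ε j : ℤ) : ℝ) * w j.succ) ^ 4) / 2 =
        w 0 ^ 4 + 6 * w 0 ^ 2 * (∑ j, ((ε j : ℤ) : ℝ) * w j.succ) ^ 2 +
          (∑ j, ((ε j : ℤ) : ℝ) * w j.succ) ^ 4 := fun ε => by ring
    rw [expect_fin_cons, Finset.expect_comm]
    simp only [Fin.sum_univ_succ, Fin.cons_zero, Fin.cons_succ, expect_intUnits]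
    push_cast
    simp only [h, Finset.expect_add_distrib, ← Finset.mul_expect, expect_sign_sum_sq,
      Fintype.expect_const]
    nlinarith [ih fun j => w j.succ, sq_nonneg (w 0 ^ 2)]

/-- A Khintchine inequality, with a constant that is not optimal. -/
lemma sqrt_sum_sq_le_expect {k : ℕ} (w : Fin k → ℝ) :
    √(∑ j, w j ^ 2) ≤ 9 / 5 * 𝔼 ε : Fin k → ℤˣ, |∑ j, ((ε j : ℤ) : ℝ) * w j| := by
  set A := √(∑ j, w j ^ 2) with hA
  have hA2 : ∑ j, w j ^ 2 = A ^ 2 := (Real.sq_sqrt (by positivity)).symm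
  have hA0 : 0 ≤ A := Real.sqrt_nonneg _
  rcases hA0.eq_or_lt with h0 | hpos
  · rw [← h0]
    have : 0 ≤ 𝔼 ε : Fin k → ℤˣ, |∑ j, ((ε j : ℤ) : ℝ) * w j| :=
      Finset.expect_nonneg fun _ _ => abs_nonneg _
    linarith
  -- The quartic is tangent to `A³|s|` at `|s| = 3A/2`; the difference of the two sides is the
  -- product shown nonnegative below. With second moment `A²` and fourth moment at most `3A⁴`,
  -- averaging leaves `A⁴ - (4/27)·3A⁴ = (5/9)A⁴`, whence `9/5`.
  have key : ∀ s : ℝ, A ^ 2 * s ^ 2 - 4 / 27 * s ^ 4 ≤ A ^ 3 * |s| := fun s => by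
    rw [← sq_abs s, show s ^ 4 = |s| ^ 4 by rw [← abs_pow]; exact (abs_of_nonneg (by positivity)).symm]
    have ht := abs_nonneg s
    have : 0 ≤ |s| * ((|s| - 3 / 2 * A) ^ 2 * (4 / 27 * (|s| + 3 * A))) := by positivity
    nlinarith
  have h1 : 𝔼 ε : Fin k → ℤˣ, (A ^ 2 * (∑ j, ((ε j : ℤ) : ℝ) * w j) ^ 2
      - 4 / 27 * (∑ j, ((ε j : ℤ) : ℝ) * w j) ^ 4)
      ≤ 𝔼 ε : Fin k → ℤˣ, A ^ 3 * |∑ j, ((ε j : ℤ) : ℝ) * w j| :=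
    Finset.expect_le_expect fun _ _ => key _
  rw [Finset.expect_sub_distrib, ← Finset.mul_expect, ← Finset.mul_expect, ← Finset.mul_expect,
    expect_sign_sum_sq, hA2] at h1
  have h4 := expect_sign_sum_pow_four w
  rw [hA2] at h4
  have h2 : A ^ 3 * A ≤ A ^ 3 * (9 / 5 * 𝔼 ε : Fin k → ℤˣ, |∑ j, ((ε j : ℤ) : ℝ) * w j|) := by
    nlinarith
  exact le_of_mul_le_mul_left h2 (by positivity)

/-! ### The vector contraction inequality -/

/-- A real function with bounded absolute value. -/
def IsBoundedFun {T : Type*} (h : T → ℝ) : Prop := ∃ C, ∀ t, |h t| ≤ C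

namespace IsBoundedFun

variable {T : Type*} {g h : T → ℝ}

lemma bddAbove (hh : IsBoundedFun h) : BddAbove (Set.range h) := by
  obtain ⟨C, hC⟩ := hh
  exact ⟨C, by rintro _ ⟨t, rfl⟩; exact (abs_le.1 (hC t)).2⟩

lemma const (c : ℝ) : IsBoundedFun fun _ : T => c := ⟨|c|, fun _ => le_rfl⟩

lemma add (hg : IsBoundedFun g) (hh : IsBoundedFun h) : IsBoundedFun fun t => g t + h t := by
  obtain ⟨C, hC⟩ := hg
  obtain ⟨D, hD⟩ := hh
  exact ⟨C + D, fun t => (abs_add_le _ _).trans (add_le_add (hC t) (hD t))⟩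

lemma const_mul (c : ℝ) (hh : IsBoundedFun h) : IsBoundedFun fun t => c * h t := by
  obtain ⟨C, hC⟩ := hh
  exact ⟨|c| * C, fun t => by rw [abs_mul]; gcongr; exact hC t⟩

lemma sub (hg : IsBoundedFun g) (hh : IsBoundedFun h) : IsBoundedFun fun t => g t - h t := by
  simpa [sub_eq_add_neg] using hg.add (hh.const_mul (-1))

lemma sum {ι : Type*} (s : Finset ι) {h : ι → T → ℝ} (hh : ∀ i, IsBoundedFun (h i)) :
    IsBoundedFun fun t => ∑ i ∈ s, h i t := by
  choose C hC using hh
  exact ⟨∑ i ∈ s, C i, fun t => (Finset.abs_sum_le_sum_abs _ _).trans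
    (Finset.sum_le_sum fun i _ => hC i t)⟩

end IsBoundedFun

/-- The two signs give a supremum over pairs `s`, `t` of `a s + a t + h s - h t`. Khintchine turns
the Lipschitz bound on `h s - h t` into an average over `ε`, and the symmetry `ε ↦ -ε` recombines
the two suprema. -/
lemma contraction_step {T : Type*} [Nonempty T] {k : ℕ} {a h : T → ℝ} {v : Fin k → T → ℝ} {ρ : ℝ}
    (hρ : 0 ≤ ρ) (ha : IsBoundedFun a) (hv : ∀ j, IsBoundedFun (v j))
    (hlip : ∀ s t, |h s - h t| ≤ ρ * √(∑ j, (v j s - v j t) ^ 2)) :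
    𝔼 e : ℤˣ, ⨆ t, (a t + ((e : ℤ) : ℝ) * h t) ≤
      𝔼 ε : Fin k → ℤˣ, ⨆ t, (a t + 9 / 5 * ρ * ∑ j, ((ε j : ℤ) : ℝ) * v j t) := by
  set S : (Fin k → ℤˣ) → ℝ :=
    fun ε => ⨆ t, (a t + 9 / 5 * ρ * ∑ j, ((ε j : ℤ) : ℝ) * v j t) with hS
  have hle : ∀ ε t, a t + 9 / 5 * ρ * ∑ j, ((ε j : ℤ) : ℝ) * v j t ≤ S ε := fun ε t =>
    le_ciSup (f := fun t => a t + 9 / 5 * ρ * ∑ j, ((ε j : ℤ) : ℝ) * v j t)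
      (ha.add ((IsBoundedFun.sum _ fun j => (hv j).const_mul _).const_mul _)).bddAbove t
  have hsym : 𝔼 ε, (S ε + S (-ε)) = 2 * 𝔼 ε, S ε := by
    rw [Finset.expect_add_distrib, expect_neg_signs]; ring
  rw [expect_intUnits]
  suffices H : (⨆ t, (a t + (((1 : ℤˣ) : ℤ) : ℝ) * h t))
      + (⨆ t, (a t + (((-1 : ℤˣ) : ℤ) : ℝ) * h t)) ≤ 2 * 𝔼 ε, S ε by linarith
  refine ciSup_add_ciSup_le fun s t => ?_
  have h1 : h s - h t ≤
      𝔼 ε : Fin k → ℤˣ, |9 / 5 * ρ * ∑ j, ((ε j : ℤ) : ℝ) * (v j s - v j t)| := by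
    simp only [abs_mul, abs_of_nonneg hρ, ← Finset.mul_expect]
    refine (le_abs_self _).trans ((hlip s t).trans ?_)
    have := mul_le_mul_of_nonneg_left (sqrt_sum_sq_le_expect fun j => v j s - v j t) hρ
    rw [abs_of_nonneg (by norm_num : (0 : ℝ) ≤ 9 / 5)]
    linarith
  have h2 : 𝔼 ε : Fin k → ℤˣ, (a s + a t +
      |9 / 5 * ρ * ∑ j, ((ε j : ℤ) : ℝ) * (v j s - v j t)|) ≤ 𝔼 ε, (S ε + S (-ε)) := by
    -- The sign of the quantity inside the absolute value decides which of `s`, `t` is paired with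
    -- `ε` and which with `-ε`.
    refine Finset.expect_le_expect fun ε _ => ?_
    have e1 := hle ε s
    have e2 := hle ε t
    have e3 := hle (-ε) s
    have e4 := hle (-ε) t
    simp only [Pi.neg_apply, Units.val_neg, Int.cast_neg, neg_mul, Finset.sum_neg_distrib]
      at e3 e4
    simp only [mul_sub, Finset.sum_sub_distrib]
    rcases abs_cases (9 / 5 * ρ * ∑ j, ((ε j : ℤ) : ℝ) * v j s
      - 9 / 5 * ρ * ∑ j, ((ε j : ℤ) : ℝ) * v j t) with h | h <;> rw [h.1] <;> linarith
  rw [Finset.expect_add_distrib, Fintype.expect_const, hsym] at h2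
  push_cast
  linarith

/-- The sample points are treated one at a time. The free term `a` carries the contribution of the
other points, which is why the induction is over all `a`. -/
lemma vector_contraction {T : Type*} [Nonempty T] {k m : ℕ} {h : Fin m → T → ℝ}
    {v : Fin m → Fin k → T → ℝ} {ρ : ℝ} (hρ : 0 ≤ ρ)
    (hh : ∀ i, IsBoundedFun (h i)) (hv : ∀ i j, IsBoundedFun (v i j))
    (hlip : ∀ i s t, |h i s - h i t| ≤ ρ * √(∑ j, (v i j s - v i j t) ^ 2))
    {a : T → ℝ} (ha : IsBoundedFun a) :
    𝔼 σ : Fin m → ℤˣ, ⨆ t, (a t + ∑ i, ((σ i : ℤ) : ℝ) * h i t) ≤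
      𝔼 ε : Fin m → Fin k → ℤˣ,
        ⨆ t, (a t + ∑ i, 9 / 5 * ρ * ∑ j, ((ε i j : ℤ) : ℝ) * v i j t) := by
  induction m generalizing a with
  | zero => simp
  | succ n ih =>
    rw [expect_fin_cons, expect_fin_cons]
    simp only [Fin.sum_univ_succ, Fin.cons_zero, Fin.cons_succ, ← add_assoc]
    calc 𝔼 e : ℤˣ, 𝔼 σ : Fin n → ℤˣ,
          ⨆ t, (a t + ((e : ℤ) : ℝ) * h 0 t + ∑ i, ((σ i : ℤ) : ℝ) * h i.succ t)
        ≤ 𝔼 e : ℤˣ, 𝔼 ε : Fin n → Fin k → ℤˣ, ⨆ t, (a t + ((e : ℤ) : ℝ) * h 0 t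
            + ∑ i, 9 / 5 * ρ * ∑ j, ((ε i j : ℤ) : ℝ) * v i.succ j t) :=
          Finset.expect_le_expect fun e _ => ih (fun i => hh i.succ) (fun i => hv i.succ)
            (fun i => hlip i.succ) (ha.add ((hh 0).const_mul _))
      _ = 𝔼 ε : Fin n → Fin k → ℤˣ, 𝔼 e : ℤˣ, ⨆ t,
            ((a t + ∑ i, 9 / 5 * ρ * ∑ j, ((ε i j : ℤ) : ℝ) * v i.succ j t)
              + ((e : ℤ) : ℝ) * h 0 t) := by
          rw [Finset.expect_comm]; simp only [add_right_comm]
      _ ≤ 𝔼 ε : Fin n → Fin k → ℤˣ, 𝔼 e : Fin k → ℤˣ, ⨆ t,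
            ((a t + ∑ i, 9 / 5 * ρ * ∑ j, ((ε i j : ℤ) : ℝ) * v i.succ j t)
              + 9 / 5 * ρ * ∑ j, ((e j : ℤ) : ℝ) * v 0 j t) :=
          Finset.expect_le_expect fun ε _ => contraction_step hρ
            (ha.add (IsBoundedFun.sum _ fun i =>
              (IsBoundedFun.sum _ fun j => (hv i.succ j).const_mul _).const_mul _))
            (hv 0) (hlip 0)
      _ = _ := by
          rw [Finset.expect_comm]; simp only [add_right_comm]

/-- The average over random signs of a composition with Lipschitz functions is controlled by the
sum of the averages of the coordinates. -/
lemma vector_contraction_sum {T : Type*} [Nonempty T] {k m : ℕ} {h : Fin m → T → ℝ}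
    {v : Fin m → Fin k → T → ℝ} {ρ : ℝ} (hρ : 0 ≤ ρ)
    (hh : ∀ i, IsBoundedFun (h i)) (hv : ∀ i j, IsBoundedFun (v i j))
    (hlip : ∀ i s t, |h i s - h i t| ≤ ρ * √(∑ j, (v i j s - v i j t) ^ 2)) :
    𝔼 σ : Fin m → ℤˣ, ⨆ t, ∑ i, ((σ i : ℤ) : ℝ) * h i t ≤
      9 / 5 * ρ * ∑ j, 𝔼 σ : Fin m → ℤˣ, ⨆ t, ∑ i, ((σ i : ℤ) : ℝ) * v i j t := by
  have h1 := vector_contraction hρ hh hv hlip (IsBoundedFun.const (T := T) 0)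
  simp only [zero_add] at h1
  have hb : ∀ (ε : Fin m → Fin k → ℤˣ) j,
      BddAbove (Set.range fun t => ∑ i, ((ε i j : ℤ) : ℝ) * v i j t) := fun ε j =>
    (IsBoundedFun.sum _ fun i => (hv i j).const_mul _).bddAbove
  refine h1.trans ?_
  calc 𝔼 ε : Fin m → Fin k → ℤˣ, ⨆ t, ∑ i, 9 / 5 * ρ * ∑ j, ((ε i j : ℤ) : ℝ) * v i j t
      ≤ 𝔼 ε : Fin m → Fin k → ℤˣ,
          9 / 5 * ρ * ∑ j, ⨆ t, ∑ i, ((ε i j : ℤ) : ℝ) * v i j t := by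
        refine Finset.expect_le_expect fun ε _ => ciSup_le fun t => ?_
        -- The supremum of a sum over coordinates is at most the sum of the suprema; for fixed `j`
        -- the column `(ε i j)ᵢ` is then a uniform sign vector.
        rw [← Finset.mul_sum, Finset.sum_comm]
        gcongr with j
        exact le_ciSup (hb ε j) t
    _ = 9 / 5 * ρ * ∑ j, 𝔼 ε : Fin m → Fin k → ℤˣ,
          ⨆ t, ∑ i, ((ε i j : ℤ) : ℝ) * v i j t := by
        rw [← Finset.mul_expect, Finset.expect_sum_comm]
    _ = _ := by
        congr 1
        refine Finset.sum_congr rfl fun j _ => ?_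
        rw [Fintype.expect_equiv (Equiv.piComm fun _ _ => ℤˣ)
          (fun ε : Fin m → Fin k → ℤˣ => ⨆ t, ∑ i, ((ε i j : ℤ) : ℝ) * v i j t)
          (fun ε => ⨆ t, ∑ i, ((ε j i : ℤ) : ℝ) * v i j t) fun _ => rfl]
        exact expect_eval j fun σ : Fin m → ℤˣ => ⨆ t, ∑ i, ((σ i : ℤ) : ℝ) * v i j t

/-! ### Bounded measurable functions -/

lemma IsBoundedFun.integrable {Y : Type*} [MeasurableSpace Y] {Q : Measure Y} [IsFiniteMeasure Q]
    {g : Y → ℝ} (hb : IsBoundedFun g) (hg : Measurable g) : Integrable g Q := by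
  obtain ⟨C, hC⟩ := hb
  exact .of_bound hg.aestronglyMeasurable C (ae_of_all _ hC)

lemma abs_integral_le_of_abs_le {Y : Type*} [MeasurableSpace Y] (Q : Measure Y)
    [IsProbabilityMeasure Q] {g : Y → ℝ} {C : ℝ} (hC : ∀ y, |g y| ≤ C) : |∫ y, g y ∂Q| ≤ C := by
  have := norm_integral_le_of_norm_le_const (μ := Q) (f := g) (ae_of_all _ hC)
  simpa using this

lemma IsBoundedFun.comp {Y Z : Type*} {g : Y → ℝ} (hb : IsBoundedFun g) (u : Z → Y) :
    IsBoundedFun fun z => g (u z) := by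
  obtain ⟨C, hC⟩ := hb
  exact ⟨C, fun z => hC _⟩

lemma IsBoundedFun.exp {Y : Type*} {g : Y → ℝ} (hb : IsBoundedFun g) :
    IsBoundedFun fun y => Real.exp (g y) := by
  obtain ⟨C, hC⟩ := hb
  exact ⟨Real.exp C, fun y => by
    rw [Real.abs_exp]; exact Real.exp_le_exp.2 ((le_abs_self _).trans (hC y))⟩

lemma isBoundedFun_iSup {T Y : Type*} [Nonempty T] {H : T → Y → ℝ}
    (hH : IsBoundedFun fun p : T × Y => H p.1 p.2) : IsBoundedFun fun y => ⨆ t, H t y := by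
  obtain ⟨C, hC⟩ := hH
  refine ⟨C, fun y => abs_le.2 ⟨?_, ciSup_le fun t => (abs_le.1 (hC (t, y))).2⟩⟩
  obtain ⟨t⟩ := ‹Nonempty T›
  exact (abs_le.1 (hC (t, y))).1.trans
    (le_ciSup (f := fun t => H t y) ⟨C, by rintro _ ⟨s, rfl⟩; exact (abs_le.1 (hC (s, y))).2⟩ t)

lemma integral_pi_fin_succ {Y : Type*} [MeasurableSpace Y] (Q : Measure Y)
    [IsProbabilityMeasure Q] {n : ℕ} {G : (Fin (n + 1) → Y) → ℝ}
    (hG : Integrable G (Measure.pi fun _ => Q)) :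
    ∫ b, G b ∂(Measure.pi fun _ => Q) =
      ∫ y, ∫ b, G (Fin.cons y b) ∂(Measure.pi fun _ : Fin n => Q) ∂Q := by
  have hmp := (measurePreserving_piFinSuccAbove (fun _ : Fin (n + 1) => Q) 0).symm
  rw [← hmp.integral_comp', integral_prod]
  · simp [MeasurableEquiv.piFinSuccAbove_symm_apply, Fin.insertNthEquiv]
  · exact (hmp.integrable_comp_emb (MeasurableEquiv.measurableEmbedding _)).2 hG

/-! ### McDiarmid's inequality -/

/-- Hoeffding's lemma: oscillation at most `c` places `h` in an interval of length `c` starting at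
its infimum, so the variance proxy is `(c/2)²`. -/
lemma integral_exp_sub_integral_le_of_sub_le {Y : Type*} [MeasurableSpace Y] (Q : Measure Y)
    [IsProbabilityMeasure Q] {h : Y → ℝ} (hh : Measurable h) (hb : IsBoundedFun h) {c : ℝ}
    (hc : ∀ y z, h z - h y ≤ c) (t : ℝ) :
    ∫ y, Real.exp (t * (h y - ∫ z, h z ∂Q)) ∂Q ≤ Real.exp (c ^ 2 / 4 * t ^ 2 / 2) := by
  obtain ⟨C, hC⟩ := hb
  have hbdd : BddBelow (Set.range h) := ⟨-C, by rintro _ ⟨y, rfl⟩; exact (abs_le.1 (hC y)).1⟩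
  have : Nonempty Y := nonempty_of_isProbabilityMeasure Q
  have hIcc : ∀ y, h y ∈ Set.Icc (⨅ z, h z) ((⨅ z, h z) + c) := fun y =>
    ⟨ciInf_le hbdd y, by
      have : h y - c ≤ ⨅ z, h z := le_ciInf fun z => by linarith [hc z y]
      linarith⟩
  have := (hasSubgaussianMGF_of_mem_Icc (μ := Q) hh.aemeasurable (ae_of_all _ hIcc)).mgf_le t
  simp only [mgf] at this
  refine this.trans (le_of_eq ?_)
  congr 1
  push_cast
  rw [add_sub_cancel_left, div_pow, Real.norm_eq_abs, sq_abs]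
  ring

/-- Fubini replaces the martingale argument. With `h y` the mean of `g` given its first coordinate,
`g - E g = (g - h) + (h - E h)`: the induction hypothesis handles the first part for each fixed `y`,
Hoeffding's lemma the second. -/
lemma integral_exp_sub_integral_le {Y : Type*} [MeasurableSpace Y] (Q : Measure Y)
    [IsProbabilityMeasure Q] {n : ℕ} {g : (Fin n → Y) → ℝ} (hg : Measurable g)
    (hb : IsBoundedFun g) {c : Fin n → ℝ}
    (hc : ∀ i b y, g (Function.update b i y) - g b ≤ c i) (t : ℝ) :
    ∫ b, Real.exp (t * (g b - ∫ a, g a ∂(Measure.pi fun _ => Q))) ∂(Measure.pi fun _ => Q) ≤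
      Real.exp ((∑ i, c i ^ 2) / 4 * t ^ 2 / 2) := by
  induction n with
  | zero =>
    have h0 : ∀ b, g b = g default := fun b => by rw [Subsingleton.elim b default]
    simp [h0]
  | succ n ih =>
    set P : Measure (Fin n → Y) := Measure.pi fun _ => Q with hP
    have hcons : Measurable fun p : Y × (Fin n → Y) => (Fin.cons p.1 p.2 : Fin (n + 1) → Y) := by
      refine measurable_pi_iff.2 fun i => ?_
      refine Fin.cases ?_ (fun i => ?_) i
      · simpa using measurable_fst
      · simp only [Fin.cons_succ]
        fun_prop
    have hcons' : ∀ y, Measurable fun b : Fin n → Y => (Fin.cons y b : Fin (n + 1) → Y) :=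
      fun y => hcons.comp measurable_prodMk_left
    set h : Y → ℝ := fun y => ∫ b, g (Fin.cons y b) ∂P with hh
    have hint : ∀ y, Integrable (fun b => g (Fin.cons y b)) P := fun y =>
      (hb.comp _).integrable (hg.comp (hcons' y))
    have hhm : Measurable h :=
      (StronglyMeasurable.integral_prod_right (ν := P) (f := fun y b => g (Fin.cons y b))
        (hg.comp hcons).stronglyMeasurable).measurable
    have hhb : IsBoundedFun h := by
      obtain ⟨C, hC⟩ := hb
      exact ⟨C, fun y => abs_integral_le_of_abs_le P fun b => hC (Fin.cons y b)⟩
    have hhc : ∀ y z, h z - h y ≤ c 0 := fun y z => by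
      rw [hh, ← integral_sub (hint z) (hint y)]
      refine (integral_mono ((hint z).sub (hint y)) (integrable_const (c 0)) fun b => ?_).trans_eq
        (by simp)
      have := hc 0 (Fin.cons y b) z
      rwa [Fin.update_cons_zero] at this
    have hE : ∫ a, g a ∂(Measure.pi fun _ => Q) = ∫ y, h y ∂Q :=
      integral_pi_fin_succ Q (hb.integrable hg)
    have hexpm : ∀ s : ℝ, Measurable fun b => Real.exp (t * (g b - s)) := fun s => by fun_prop
    have hexpb : ∀ s : ℝ, IsBoundedFun fun b => Real.exp (t * (g b - s)) := fun s =>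
      ((hb.sub (.const s)).const_mul t).exp
    rw [integral_pi_fin_succ Q ((hexpb _).integrable (hexpm _)), hE]
    have hinner : ∀ y, ∫ b, Real.exp (t * (g (Fin.cons y b) - ∫ y, h y ∂Q)) ∂P ≤
        Real.exp (t * (h y - ∫ y, h y ∂Q)) *
          Real.exp ((∑ i : Fin n, c i.succ ^ 2) / 4 * t ^ 2 / 2) := fun y => by
      have e : ∀ b : Fin n → Y, Real.exp (t * (g (Fin.cons y b) - ∫ y, h y ∂Q)) =
          Real.exp (t * (h y - ∫ y, h y ∂Q)) * Real.exp (t * (g (Fin.cons y b) - h y)) :=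
        fun b => by rw [← Real.exp_add]; congr 1; ring
      simp only [e]
      rw [integral_const_mul]
      refine mul_le_mul_of_nonneg_left ?_ (Real.exp_nonneg _)
      exact ih (hg.comp (hcons' y)) (hb.comp _) (c := fun i => c i.succ) fun i b z => by
        have := hc i.succ (Fin.cons y b) z
        rwa [← Fin.cons_update] at this
    calc ∫ y, ∫ b, Real.exp (t * (g (Fin.cons y b) - ∫ y, h y ∂Q)) ∂P ∂Q
        ≤ ∫ y, Real.exp (t * (h y - ∫ y, h y ∂Q)) *
          Real.exp ((∑ i : Fin n, c i.succ ^ 2) / 4 * t ^ 2 / 2) ∂Q := by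
          refine integral_mono_of_nonneg
            (ae_of_all _ fun y => integral_nonneg fun b => (Real.exp_nonneg _)) ?_
            (ae_of_all _ hinner)
          exact Integrable.mul_const ((((hhb.sub (.const _)).const_mul t).exp).integrable
            (by fun_prop)) _
      _ ≤ Real.exp (c 0 ^ 2 / 4 * t ^ 2 / 2) *
          Real.exp ((∑ i : Fin n, c i.succ ^ 2) / 4 * t ^ 2 / 2) := by
          rw [integral_mul_const]
          exact mul_le_mul_of_nonneg_right
            (integral_exp_sub_integral_le_of_sub_le Q hhm hhb hhc t) (Real.exp_nonneg _)
      _ = _ := by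
          rw [← Real.exp_add, Fin.sum_univ_succ]; congr 1; ring

/-- **McDiarmid's inequality**. -/
theorem measure_sub_integral_ge_le_of_bounded_difference {Y : Type*} [MeasurableSpace Y]
    (Q : Measure Y) [IsProbabilityMeasure Q] {n : ℕ} {g : (Fin n → Y) → ℝ} (hg : Measurable g)
    (hb : IsBoundedFun g) {c : Fin n → ℝ}
    (hc : ∀ i b y, g (Function.update b i y) - g b ≤ c i) {s : ℝ} (hs : 0 ≤ s) :
    (Measure.pi fun _ => Q).real {b | s ≤ g b - ∫ a, g a ∂(Measure.pi fun _ => Q)} ≤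
      Real.exp (-2 * s ^ 2 / ∑ i, c i ^ 2) := by
  have hsub : HasSubgaussianMGF (fun b => g b - ∫ a, g a ∂(Measure.pi fun _ => Q))
      (Real.toNNReal ((∑ i, c i ^ 2) / 4)) (Measure.pi fun _ => Q) := by
    refine ⟨fun t => (((hb.sub (.const _)).const_mul t).exp).integrable (by fun_prop), fun t => ?_⟩
    rw [Real.coe_toNNReal _ (by positivity)]
    exact integral_exp_sub_integral_le Q hg hb hc t
  refine (hsub.measure_ge_le hs).trans_eq ?_
  rw [Real.coe_toNNReal _ (by positivity)]
  congr 1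
  -- If all `c i` vanish, both exponents are divisions by zero, hence `0`.
  rcases eq_or_ne (∑ i, c i ^ 2) 0 with h | h
  · simp [h]
  · field_simp; ring

/-! ### Symmetrization -/

lemma isBoundedFun_signed_mean {T Y : Type*} {φ : T → Y → ℝ}
    (hφb : IsBoundedFun fun p : T × Y => φ p.1 p.2) {m : ℕ}
    (a : Fin m → ℝ) :
    IsBoundedFun fun p : T × (Fin m → Y) => 1 / (m : ℝ) * ∑ i, a i * φ p.1 (p.2 i) :=
  (IsBoundedFun.sum _ fun i =>
    (hφb.comp fun p : T × (Fin m → Y) => (p.1, p.2 i)).const_mul (a i)).const_mul _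

section Symmetrization

variable {T Y : Type*} [MeasurableSpace Y] {φ : T → Y → ℝ}

lemma measurable_iSup_signed_mean [Countable T] (hφ : ∀ t, Measurable (φ t)) {m : ℕ}
    (a : Fin m → ℝ) :
    Measurable fun b : Fin m → Y => ⨆ t, 1 / (m : ℝ) * ∑ i, a i * φ t (b i) := by
  refine Measurable.iSup fun t => ?_
  have := hφ t
  fun_prop

lemma integral_mean_pi (Q : Measure Y) [IsProbabilityMeasure Q] {m : ℕ} (hm : 1 ≤ m) {g : Y → ℝ}
    (hg : Integrable g Q) :
    ∫ b, 1 / (m : ℝ) * ∑ i, g (b i) ∂(Measure.pi fun _ : Fin m => Q) = ∫ y, g y ∂Q := by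
  have hev : ∀ i : Fin m, MeasurePreserving (fun b : Fin m → Y => b i)
      (Measure.pi fun _ => Q) Q := fun i => measurePreserving_eval (fun _ => Q) i
  have hi : ∀ i : Fin m, ∫ b, g (b i) ∂(Measure.pi fun _ : Fin m => Q) = ∫ y, g y ∂Q := fun i => by
    rw [← (hev i).map_eq, integral_map (hev i).measurable.aemeasurable
      (by rw [(hev i).map_eq]; exact hg.aestronglyMeasurable)]
    rw [(hev i).map_eq]
  rw [integral_const_mul,
    integral_finsetSum (f := fun i (b : Fin m → Y) => g (b i)) _
      fun i _ => (hev i).integrable_comp_of_integrable hg]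
  simp only [hi, Finset.sum_const, Finset.card_univ, Fintype.card_fin, nsmul_eq_mul]
  field_simp

/-- The expected supremum of the deviations of the empirical means is at most twice the
Rademacher complexity. -/
lemma integral_iSup_deviation_le [Countable T] [Nonempty T] (Q : Measure Y)
    [IsProbabilityMeasure Q] (hφ : ∀ t, Measurable (φ t))
    (hφb : IsBoundedFun fun p : T × Y => φ p.1 p.2) {m : ℕ} (hm : 1 ≤ m) :
    ∫ b, (⨆ t, (∫ y, φ t y ∂Q - 1 / (m : ℝ) * ∑ i, φ t (b i)))
        ∂(Measure.pi fun _ : Fin m => Q) ≤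
      2 * 𝔼 σ : Fin m → ℤˣ, ∫ b, (⨆ t, 1 / (m : ℝ) * ∑ i, ((σ i : ℤ) : ℝ) * φ t (b i))
        ∂(Measure.pi fun _ : Fin m => Q) := by
  set P : Measure (Fin m → Y) := Measure.pi fun _ => Q with hP
  -- The sample and its ghost copy are stored as i.i.d. pairs, so that swapping the two entries at
  -- chosen indices preserves the law.
  set P₂ : Measure (Fin m → Y × Y) := Measure.pi fun _ => Q.prod Q with hP₂
  set S : (Fin m → ℤˣ) → (Fin m → Y) → ℝ :=
    fun σ b => ⨆ t, 1 / (m : ℝ) * ∑ i, ((σ i : ℤ) : ℝ) * φ t (b i) with hS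
  set ψ : T → Y × Y → ℝ := fun t z => φ t z.2 - φ t z.1 with hψ
  set D : (Fin m → ℤˣ) → (Fin m → Y × Y) → ℝ :=
    fun σ z => ⨆ t, 1 / (m : ℝ) * ∑ i, ((σ i : ℤ) : ℝ) * ψ t (z i) with hD
  have hψm : ∀ t, Measurable (ψ t) := fun t =>
    ((hφ t).comp measurable_snd).sub ((hφ t).comp measurable_fst)
  have hψb : IsBoundedFun fun p : T × (Y × Y) => ψ p.1 p.2 :=
    (hφb.comp fun p : T × (Y × Y) => (p.1, p.2.2)).sub
      (hφb.comp fun p : T × (Y × Y) => (p.1, p.2.1))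
  have hφt : ∀ t, IsBoundedFun (φ t) := fun t => hφb.comp fun y => (t, y)
  have hφi : ∀ t, Integrable (φ t) Q := fun t => (hφt t).integrable (hφ t)
  have hSm : ∀ σ, Measurable (S σ) := fun σ => measurable_iSup_signed_mean hφ _
  have hSb : ∀ σ, IsBoundedFun (S σ) := fun σ =>
    isBoundedFun_iSup (isBoundedFun_signed_mean hφb _)
  have hDm : ∀ σ, Measurable (D σ) := fun σ => measurable_iSup_signed_mean hψm _
  have hDb : ∀ σ, IsBoundedFun (D σ) := fun σ =>
    isBoundedFun_iSup (isBoundedFun_signed_mean hψb _)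
  have hle : ∀ t σ z, 1 / (m : ℝ) * ∑ i, ((σ i : ℤ) : ℝ) * ψ t (z i) ≤ D σ z := fun t σ z =>
    le_ciSup (f := fun t => 1 / (m : ℝ) * ∑ i, ((σ i : ℤ) : ℝ) * ψ t (z i))
      ((isBoundedFun_signed_mean hψb fun i => ((σ i : ℤ) : ℝ)).comp fun t => (t, z)).bddAbove t
  have hleS : ∀ t σ b, 1 / (m : ℝ) * ∑ i, ((σ i : ℤ) : ℝ) * φ t (b i) ≤ S σ b := fun t σ b =>
    le_ciSup (f := fun t => 1 / (m : ℝ) * ∑ i, ((σ i : ℤ) : ℝ) * φ t (b i))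
      ((isBoundedFun_signed_mean hφb fun i => ((σ i : ℤ) : ℝ)).comp fun t => (t, b)).bddAbove t
  have hmeanm : ∀ t, Measurable fun b : Fin m → Y => 1 / (m : ℝ) * ∑ i, φ t (b i) := fun t => by
    have := hφ t
    fun_prop
  have hmeanb : IsBoundedFun fun p : T × (Fin m → Y) => 1 / (m : ℝ) * ∑ i, φ p.1 (p.2 i) := by
    simpa using isBoundedFun_signed_mean hφb (m := m) fun _ => 1
  have harrow := measurePreserving_arrowProdEquivProdArrow Y Y (Fin m) (fun _ => Q) (fun _ => Q)
  have hpair : Measurable fun p : (Fin m → Y) × (Fin m → Y) =>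
      (fun i => (p.1 i, p.2 i) : Fin m → Y × Y) := by fun_prop
  -- comparison with an independent copy of the sample
  have hghost : ∫ b, (⨆ t, (∫ y, φ t y ∂Q - 1 / (m : ℝ) * ∑ i, φ t (b i))) ∂P ≤
      ∫ z, D 1 z ∂P₂ := by
    have h1 : ∀ b : Fin m → Y, (⨆ t, (∫ y, φ t y ∂Q - 1 / (m : ℝ) * ∑ i, φ t (b i))) ≤
        ∫ b' : Fin m → Y, D 1 (fun i => (b i, b' i)) ∂P := fun b => by
      refine ciSup_le fun t => ?_
      have hmi : Integrable (fun b' : Fin m → Y => 1 / (m : ℝ) * ∑ i, φ t (b' i)) P :=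
        (hmeanb.comp fun b' => (t, b')).integrable (hmeanm t)
      calc ∫ y, φ t y ∂Q - 1 / (m : ℝ) * ∑ i, φ t (b i)
          = ∫ b', (1 / (m : ℝ) * ∑ i, φ t (b' i) - 1 / (m : ℝ) * ∑ i, φ t (b i)) ∂P := by
            rw [integral_sub hmi (integrable_const _), integral_mean_pi Q hm (hφi t)]
            simp
        _ ≤ ∫ b', D 1 (fun i => (b i, b' i)) ∂P := by
            refine integral_mono (hmi.sub (integrable_const _)) (((hDb 1).comp _).integrable
              ((hDm 1).comp (by fun_prop))) fun b' => ?_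
            refine le_trans (le_of_eq ?_) (hle t 1 fun i => (b i, b' i))
            simp [hψ, Finset.sum_sub_distrib, mul_sub]
    have hDp : Integrable (fun p : (Fin m → Y) × (Fin m → Y) => D 1 (fun i => (p.1 i, p.2 i)))
        (P.prod P) := ((hDb 1).comp _).integrable ((hDm 1).comp hpair)
    calc ∫ b, (⨆ t, (∫ y, φ t y ∂Q - 1 / (m : ℝ) * ∑ i, φ t (b i))) ∂P
        ≤ ∫ b, ∫ b', D 1 (fun i => (b i, b' i)) ∂P ∂P := by
          refine integral_mono (IsBoundedFun.integrable ?_ ?_) hDp.integral_prod_left h1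
          · refine isBoundedFun_iSup (IsBoundedFun.sub ?_ hmeanb)
            obtain ⟨C, hC⟩ := hφb
            exact ⟨C, fun p => abs_integral_le_of_abs_le Q fun y => hC (p.1, y)⟩
          · exact Measurable.iSup fun t => (hmeanm t).const_sub _
      _ = ∫ p, D 1 (fun i => (p.1 i, p.2 i)) ∂(P.prod P) := (integral_prod _ hDp).symm
      _ = ∫ z, D 1 z ∂P₂ := by
          rw [← harrow.integral_comp']
          rfl
  -- exchanging the copies at the indices with a negative sign
  have hswap : ∀ σ : Fin m → ℤˣ, ∫ z, D 1 z ∂P₂ = ∫ z, D σ z ∂P₂ := fun σ => by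
    have hmp : MeasurePreserving
        (fun (z : Fin m → Y × Y) i => if σ i = 1 then z i else (z i).swap) P₂ P₂ := by
      refine measurePreserving_pi (fun _ : Fin m => Q.prod Q) (fun _ => Q.prod Q)
        (f := fun i w => if σ i = 1 then w else w.swap) fun i => ?_
      by_cases h : σ i = 1
      · simp only [h, if_true]
        exact MeasurePreserving.id (Q.prod Q)
      · simpa [h] using Measure.measurePreserving_swap (μ := Q) (ν := Q)
    rw [← hmp.map_eq, integral_map hmp.measurable.aemeasurable (hDm 1).aestronglyMeasurable,
      hmp.map_eq]
    refine integral_congr_ae (ae_of_all _ fun z => ?_)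
    simp only [hD]
    congr 1
    ext t
    congr 1
    refine Finset.sum_congr rfl fun i _ => ?_
    rcases Int.units_eq_one_or (σ i) with h | h
    · simp [h]
    · simp [h, hψ]
  have hfst : MeasurePreserving (fun (z : Fin m → Y × Y) i => (z i).1) P₂ P :=
    measurePreserving_pi (fun _ : Fin m => Q.prod Q) (fun _ => Q) fun _ => measurePreserving_fst
  have hsnd : MeasurePreserving (fun (z : Fin m → Y × Y) i => (z i).2) P₂ P :=
    measurePreserving_pi (fun _ : Fin m => Q.prod Q) (fun _ => Q) fun _ => measurePreserving_snd
  have hSint : ∀ σ {f : (Fin m → Y × Y) → Fin m → Y}, MeasurePreserving f P₂ P →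
      Integrable (fun z => S σ (f z)) P₂ ∧ ∫ z, S σ (f z) ∂P₂ = ∫ b, S σ b ∂P := fun σ f hf => by
    refine ⟨((hSb σ).comp _).integrable ((hSm σ).comp hf.measurable), ?_⟩
    rw [← hf.map_eq, integral_map hf.measurable.aemeasurable (hSm σ).aestronglyMeasurable]
  -- The supremum of a difference is at most the sum of two suprema; the minus sign is absorbed into
  -- `-σ`.
  have hsplit : ∀ σ, ∫ z, D σ z ∂P₂ ≤ ∫ b, S σ b ∂P + ∫ b, S (-σ) b ∂P := fun σ => by
    rw [← (hSint σ hsnd).2, ← (hSint (-σ) hfst).2,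
      ← integral_add (hSint σ hsnd).1 (hSint (-σ) hfst).1]
    refine integral_mono ((hDb σ).integrable (hDm σ))
      ((hSint σ hsnd).1.add (hSint (-σ) hfst).1) fun z => ciSup_le fun t => ?_
    refine le_trans (le_of_eq ?_)
      (add_le_add (hleS t σ fun i => (z i).2) (hleS t (-σ) fun i => (z i).1))
    simp only [hψ, mul_sub, Finset.sum_sub_distrib, Pi.neg_apply, Units.val_neg, Int.cast_neg,
      neg_mul, Finset.sum_neg_distrib]
    ring
  calc _ ≤ ∫ z, D 1 z ∂P₂ := hghost
    _ = 𝔼 σ : Fin m → ℤˣ, ∫ z, D σ z ∂P₂ := by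
        rw [← Finset.expect_congr rfl fun σ _ => hswap σ, Fintype.expect_const]
    _ ≤ 𝔼 σ : Fin m → ℤˣ, (∫ b, S σ b ∂P + ∫ b, S (-σ) b ∂P) :=
        Finset.expect_le_expect fun σ _ => hsplit σ
    _ = _ := by
        rw [Finset.expect_add_distrib, expect_neg_signs fun σ => ∫ b, S σ b ∂P]
        ring

end Symmetrization

/-! ### The loss on a bag -/

section Loss

variable {X : Type*} {k : ℕ} {l : BagLoss k} {F : Set (X → ℝ)} {ρ M : ℝ}

lemma abs_lossOnBag_le (hbdd : LossBounded l F M) {f : X → ℝ} (hf : f ∈ F)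
    (b : LabeledBag k X) : |lossOnBag l f b| ≤ M := by
  obtain ⟨h1, h2⟩ := hbdd (fun j => (b j).2) _ ⟨f, hf, fun j => (b j).1, rfl⟩
  have e1 := EReal.toReal_le_toReal h1 (EReal.coe_ne_bot _)
    (ne_top_of_le_ne_top (EReal.coe_ne_top _) h2)
  have e2 := EReal.toReal_le_toReal h2 (ne_bot_of_le_ne_bot (EReal.coe_ne_bot _) h1)
    (EReal.coe_ne_top _)
  exact abs_le.2 ⟨e1, e2⟩

lemma abs_lossOnBag_sub_le (hlip : LossLipschitz l F ρ) {f g : X → ℝ} (hf : f ∈ F) (hg : g ∈ F)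
    (b : LabeledBag k X) :
    |lossOnBag l f b - lossOnBag l g b| ≤ ρ * √(∑ j, (f (b j).1 - g (b j).1) ^ 2) :=
  hlip (fun j => (b j).2) _ ⟨f, hf, fun j => (b j).1, rfl⟩ _ ⟨g, hg, fun j => (b j).1, rfl⟩

lemma tendsto_lossOnBag (hlip : LossLipschitz l F ρ) {f : X → ℝ} (hf : f ∈ F) {u : ℕ → X → ℝ}
    (hu : ∀ n, u n ∈ F) (hlim : ∀ x, Tendsto (fun n => u n x) atTop (𝓝 (f x)))
    (b : LabeledBag k X) :
    Tendsto (fun n => lossOnBag l (u n) b) atTop (𝓝 (lossOnBag l f b)) := by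
  rw [tendsto_iff_dist_tendsto_zero]
  refine squeeze_zero (fun _ => dist_nonneg) (fun n => abs_lossOnBag_sub_le hlip (hu n) hf b) ?_
  have h : Tendsto (fun n => ρ * √(∑ j, (u n (b j).1 - f (b j).1) ^ 2)) atTop
      (𝓝 (ρ * √(∑ j, (f (b j).1 - f (b j).1) ^ 2))) :=
    ((tendsto_finsetSum _ fun j _ => ((hlim (b j).1).sub_const _).pow 2).sqrt).const_mul ρ
  simpa using h

variable [MeasurableSpace X]

lemma measurable_countProb_bag {f : X → ℝ} (hf : Measurable f) :
    Measurable fun b : LabeledBag k X =>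
      countProb (fun j => f (b j).1) (k * labelProportion fun j => (b j).2) := by
  have hlab : Measurable fun b : LabeledBag k X =>
      (k : ℝ) * labelProportion fun j => (b j).2 := by
    have h : ∀ j, Measurable fun b : LabeledBag k X => (((b j).2 : ℕ) : ℝ) := fun j =>
      (measurable_of_countable fun y : Fin 2 => ((y : ℕ) : ℝ)).comp
        (measurable_snd.comp (measurable_pi_apply j))
    unfold labelProportion
    fun_prop
  have hval : ∀ j, Measurable fun b : LabeledBag k X => f (b j).1 := fun j => by fun_prop
  unfold countProb
  refine Finset.measurable_fun_sum _ fun y _ => Measurable.ite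
    (measurableSet_eq_fun measurable_const hlab)
    (Finset.measurable_fun_prod _ fun j _ => ?_) measurable_const
  split_ifs
  · exact hval j
  · exact (hval j).const_sub 1

lemma measurable_lossOnBag (hl : l = countLoss k ∨ l = countLikelihoodLoss k) {f : X → ℝ}
    (hf : Measurable f) : Measurable (lossOnBag l f) := by
  have h := measurable_countProb_bag (k := k) hf
  rcases hl with rfl | rfl
  · have e : lossOnBag (countLoss k) f = fun b => -(ENNReal.log (ENNReal.ofReal
        (countProb (fun j => f (b j).1) (k * labelProportion fun j => (b j).2)))).toReal := by
      ext b
      simp only [lossOnBag, countLoss]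
      exact EReal.toReal_neg_eq
    rw [e]
    exact (ENNReal.measurable_log.comp h.ennreal_ofReal).ereal_toReal.neg
  · exact h.neg

end Loss

/-! ### Suprema over a separable class -/

/-- This replaces uncountable suprema, whose measurability is unclear, by countable ones, for
functionals continuous along pointwise limits. -/
lemma le_iSup_of_pointwise_limit {X : Type*} {F₀ F : Set (X → ℝ)}
    (hdense : ∀ f ∈ F, ∃ u : ℕ → X → ℝ, (∀ n, u n ∈ F₀) ∧
      ∀ x, Tendsto (fun n => u n x) atTop (𝓝 (f x)))
    {G : (X → ℝ) → ℝ}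
    (hG : ∀ f ∈ F, ∀ u : ℕ → X → ℝ, (∀ n, u n ∈ F₀) →
      (∀ x, Tendsto (fun n => u n x) atTop (𝓝 (f x))) →
      Tendsto (fun n => G (u n)) atTop (𝓝 (G f)))
    (hb : IsBoundedFun fun t : F₀ => G t) {f : X → ℝ} (hf : f ∈ F) :
    G f ≤ ⨆ t : F₀, G t := by
  obtain ⟨u, hu, hlim⟩ := hdense f hf
  exact le_of_tendsto' (hG f hf u hu hlim) fun n =>
    le_ciSup (f := fun t : F₀ => G t) hb.bddAbove ⟨u n, hu n⟩

/-! ### Rademacher complexity of a separable class -/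

section Rademacher

variable {X : Type*} {F₀ F : Set (X → ℝ)}

lemma isBoundedFun_apply (hF_unit : ∀ f ∈ F, ∀ x, f x ∈ Set.Icc (0 : ℝ) 1) :
    IsBoundedFun fun p : F × X => (p.1 : X → ℝ) p.2 :=
  ⟨1, fun p => by
    obtain ⟨h0, h1⟩ := hF_unit _ p.1.2 p.2
    rwa [abs_of_nonneg h0]⟩

lemma empiricalRademacher_eq_expect {m : ℕ} (x : Fin m → X) :
    empiricalRademacher F x =
      𝔼 σ : Fin m → ℤˣ, ⨆ f : F, 1 / (m : ℝ) * ∑ i, ((σ i : ℤ) : ℝ) * (f : X → ℝ) (x i) := by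
  rw [empiricalRademacher, Fintype.expect_eq_sum_div_card]
  have : Fintype.card ℤˣ = 2 := rfl
  simp [this, div_eq_inv_mul]

lemma empiricalRademacher_eq_of_dense (hF₀ : F₀ ⊆ F) (hne : F.Nonempty)
    (hF_unit : ∀ f ∈ F, ∀ x, f x ∈ Set.Icc (0 : ℝ) 1)
    (hdense : ∀ f ∈ F, ∃ u : ℕ → X → ℝ, (∀ n, u n ∈ F₀) ∧
      ∀ x, Tendsto (fun n => u n x) atTop (𝓝 (f x))) {m : ℕ} (x : Fin m → X) :
    empiricalRademacher F x = empiricalRademacher F₀ x := by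
  have hne₀ : Nonempty F₀ := by
    obtain ⟨f, hf⟩ := hne
    obtain ⟨u, hu, -⟩ := hdense f hf
    exact ⟨⟨u 0, hu 0⟩⟩
  have : Nonempty F := hne.to_subtype
  simp only [empiricalRademacher_eq_expect]
  refine Finset.expect_congr rfl fun σ _ => ?_
  have hb : ∀ {A : Set (X → ℝ)}, A ⊆ F → IsBoundedFun fun f : A =>
      1 / (m : ℝ) * ∑ i, ((σ i : ℤ) : ℝ) * (f : X → ℝ) (x i) := fun hA =>
    (isBoundedFun_signed_mean (isBoundedFun_apply fun f hf => hF_unit f (hA hf))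
      fun i => ((σ i : ℤ) : ℝ)).comp fun f => (f, x)
  refine le_antisymm (ciSup_le fun f => ?_) (ciSup_le fun t => ?_)
  · exact le_iSup_of_pointwise_limit (G := fun f => 1 / (m : ℝ) * ∑ i, ((σ i : ℤ) : ℝ) * f (x i))
      hdense (fun f _ u _ hlim => (tendsto_finsetSum _ fun i _ =>
        (hlim (x i)).const_mul _).const_mul _) (hb hF₀) f.2
  · exact le_ciSup (f := fun f : F => 1 / (m : ℝ) * ∑ i, ((σ i : ℤ) : ℝ) * (f : X → ℝ) (x i))
      (hb subset_rfl).bddAbove ⟨t, hF₀ t.2⟩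

/-- For a single classifier the signed mean is odd in `σ` and averages to zero; the supremum can
only be larger. -/
lemma empiricalRademacher_nonneg (hne : F.Nonempty)
    (hF_unit : ∀ f ∈ F, ∀ x, f x ∈ Set.Icc (0 : ℝ) 1) {m : ℕ} (x : Fin m → X) :
    0 ≤ empiricalRademacher F x := by
  obtain ⟨f, hf⟩ := hne
  set g : (Fin m → ℤˣ) → ℝ := fun σ => 1 / (m : ℝ) * ∑ i, ((σ i : ℤ) : ℝ) * f (x i) with hg
  have hodd : ∀ σ, g (-σ) = - g σ := fun σ => by simp [hg]
  have h0 : 𝔼 σ, g σ = 0 := by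
    have := expect_neg_signs g
    simp only [hodd, Finset.expect_neg_distrib] at this
    linarith
  rw [empiricalRademacher_eq_expect, ← h0]
  refine Finset.expect_le_expect fun σ _ => ?_
  exact le_ciSup (f := fun f : F => 1 / (m : ℝ) * ∑ i, ((σ i : ℤ) : ℝ) * (f : X → ℝ) (x i))
    ((isBoundedFun_signed_mean (isBoundedFun_apply hF_unit) fun i => ((σ i : ℤ) : ℝ)).comp
      fun f => (f, x)).bddAbove ⟨f, hf⟩

lemma rademacher_nonneg [MeasurableSpace X] (hne : F.Nonempty)
    (hF_unit : ∀ f ∈ F, ∀ x, f x ∈ Set.Icc (0 : ℝ) 1) (ν : Measure X) (m : ℕ) :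
    0 ≤ rademacher F ν m :=
  integral_nonneg fun x => empiricalRademacher_nonneg hne hF_unit x

lemma measurable_empiricalRademacher [MeasurableSpace X] [Countable F]
    (hF_meas : ∀ f ∈ F, Measurable f) (m : ℕ) :
    Measurable fun x : Fin m → X => empiricalRademacher F x := by
  unfold empiricalRademacher
  refine (Finset.measurable_fun_sum _ fun σ _ => ?_).const_mul _
  exact measurable_iSup_signed_mean (φ := fun (f : F) x => (f : X → ℝ) x)
    (fun f => hF_meas f f.2) _

lemma isBoundedFun_empiricalRademacher [Nonempty F]
    (hF_unit : ∀ f ∈ F, ∀ x, f x ∈ Set.Icc (0 : ℝ) 1) (m : ℕ) :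
    IsBoundedFun fun x : Fin m → X => empiricalRademacher F x := by
  unfold empiricalRademacher
  exact (IsBoundedFun.sum _ fun σ => isBoundedFun_iSup
    (isBoundedFun_signed_mean (isBoundedFun_apply hF_unit) _)).const_mul _

end Rademacher

/-! ### Replacing one bag, and the law of the sample -/

lemma sum_update_sub_sum {ι Y : Type*} [Fintype ι] [DecidableEq ι] (g : Y → ℝ) (b : ι → Y) (i : ι)
    (y : Y) : ∑ j, g (Function.update b i y j) - ∑ j, g (b j) = g y - g (b i) := by
  rw [← Finset.sum_sub_distrib, Finset.sum_eq_single i]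
  · simp
  · intro j _ hj
    simp [hj]
  · simp

/-- The law of a finite initial segment of an i.i.d. sequence. -/
lemma map_initial_segment_eq_pi {Ω Y : Type*} [MeasurableSpace Ω] [MeasurableSpace Y]
    {μ : Measure Ω} [IsProbabilityMeasure μ] {Q : Measure Y} {B : ℕ → Ω → Y}
    (hB_meas : ∀ i, Measurable (B i)) (hB_law : ∀ i, μ.map (B i) = Q) (hB_indep : iIndepFun B μ)
    (m : ℕ) : μ.map (fun ω (i : Fin m) => B i ω) = Measure.pi fun _ => Q := by
  have h := (iIndepFun_iff_map_fun_eq_pi_map fun i : Fin m => (hB_meas i).aemeasurable).1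
    (hB_indep.precomp (g := fun i : Fin m => (i : ℕ)) Fin.val_injective)
  simpa only [hB_law] using h


lemma isBoundedFun_lossOnBag {X : Type*} {k : ℕ} {l : BagLoss k} {F₀ F : Set (X → ℝ)} {M : ℝ}
    (hF₀ : F₀ ⊆ F) (hbdd : LossBounded l F M) :
    IsBoundedFun fun p : F₀ × LabeledBag k X => lossOnBag l (p.1 : X → ℝ) p.2 :=
  ⟨M, fun p => abs_lossOnBag_le hbdd (hF₀ p.1.2) p.2⟩

/-! ### Uniform deviation of the mean losses -/

section Deviation

variable {X : Type*} [MeasurableSpace X] {k : ℕ} {l : BagLoss k} {F₀ F : Set (X → ℝ)} {ρ M : ℝ}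

/-- The Rademacher complexity of the loss class is bounded by the sum of the Rademacher
complexities of the classifiers on the instances. -/
lemma expect_integral_iSup_loss_le (Q : Measure (LabeledBag k X)) [IsProbabilityMeasure Q]
    (hF_meas : ∀ f ∈ F, Measurable f) (hF_unit : ∀ f ∈ F, ∀ x, f x ∈ Set.Icc (0 : ℝ) 1)
    (hF₀ : F₀ ⊆ F) [Countable F₀] (hne : F.Nonempty)
    (hdense : ∀ f ∈ F, ∃ u : ℕ → X → ℝ, (∀ n, u n ∈ F₀) ∧
      ∀ x, Tendsto (fun n => u n x) atTop (𝓝 (f x)))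
    (hl : l = countLoss k ∨ l = countLikelihoodLoss k) (hρ : 0 ≤ ρ)
    (hlip : LossLipschitz l F ρ) (hbdd : LossBounded l F M) (m : ℕ) :
    𝔼 σ : Fin m → ℤˣ, ∫ b, (⨆ t : F₀, 1 / (m : ℝ) * ∑ i, ((σ i : ℤ) : ℝ) * lossOnBag l t (b i))
        ∂(Measure.pi fun _ : Fin m => Q) ≤
      9 / 5 * ρ * ∑ j, rademacher F (instanceLaw Q j) m := by
  have hne₀ : Nonempty F₀ := by
    obtain ⟨f, hf⟩ := hne
    obtain ⟨u, hu, -⟩ := hdense f hf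
    exact ⟨⟨u 0, hu 0⟩⟩
  set P : Measure (Fin m → LabeledBag k X) := Measure.pi fun _ => Q
  have hF₀_unit : ∀ f ∈ F₀, ∀ x, f x ∈ Set.Icc (0 : ℝ) 1 := fun f hf => hF_unit f (hF₀ hf)
  have hF₀_meas : ∀ f ∈ F₀, Measurable f := fun f hf => hF_meas f (hF₀ hf)
  have hφm : ∀ t : F₀, Measurable (lossOnBag l (t : X → ℝ)) := fun t =>
    measurable_lossOnBag hl (hF₀_meas t t.2)
  have hφb := isBoundedFun_lossOnBag hF₀ hbdd
  have hlossint : ∀ σ : Fin m → ℤˣ, Integrable (fun b : Fin m → LabeledBag k X =>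
      ⨆ t : F₀, 1 / (m : ℝ) * ∑ i, ((σ i : ℤ) : ℝ) * lossOnBag l t (b i)) P := fun σ =>
    (isBoundedFun_iSup (isBoundedFun_signed_mean
        (φ := fun (t : F₀) => lossOnBag l (t : X → ℝ)) hφb _)).integrable
      (measurable_iSup_signed_mean hφm _)
  -- Instances within one bag may be dependent, but the `j`-th instances of independent bags are
  -- i.i.d. with law `ν_j`.
  have hmp : ∀ j, MeasurePreserving (fun (b : Fin m → LabeledBag k X) i => (b i j).1) P
      (Measure.pi fun _ => instanceLaw Q j) := fun j => by
    have hj : Measurable fun b : LabeledBag k X => (b j).1 := by fun_prop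
    have : IsProbabilityMeasure (instanceLaw Q j) := Measure.isProbabilityMeasure_map hj.aemeasurable
    exact measurePreserving_pi (fun _ : Fin m => Q) (fun _ => instanceLaw Q j)
      fun _ => ⟨hj, rfl⟩
  have hradint : ∀ j, Integrable (fun b : Fin m → LabeledBag k X =>
      empiricalRademacher F₀ fun i => (b i j).1) P := fun j =>
    ((isBoundedFun_empiricalRademacher hF₀_unit m).comp _).integrable
      ((measurable_empiricalRademacher hF₀_meas m).comp (hmp j).measurable)
  have hrad : ∀ j, ∫ b, empiricalRademacher F₀ (fun i => (b i j).1) ∂P =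
      rademacher F (instanceLaw Q j) m := fun j => by
    simp only [rademacher, empiricalRademacher_eq_of_dense hF₀ hne hF_unit hdense]
    rw [← (hmp j).map_eq, integral_map (hmp j).measurable.aemeasurable
      (measurable_empiricalRademacher hF₀_meas m).aestronglyMeasurable]
  -- Contraction is applied with the bags held fixed; integration over them comes afterwards.
  have hpt : ∀ b : Fin m → LabeledBag k X,
      𝔼 σ : Fin m → ℤˣ, (⨆ t : F₀, 1 / (m : ℝ) * ∑ i, ((σ i : ℤ) : ℝ) * lossOnBag l t (b i)) ≤
        9 / 5 * ρ * ∑ j, empiricalRademacher F₀ fun i => (b i j).1 := fun b => by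
    have hm0 : (0 : ℝ) ≤ 1 / m := by positivity
    have hc := vector_contraction_sum (T := F₀) (h := fun i t => lossOnBag l t (b i))
      (v := fun i j t => (t : X → ℝ) (b i j).1) hρ
      (fun i => hφb.comp fun t => (t, b i))
      (fun i j => (isBoundedFun_apply hF₀_unit).comp fun t => (t, (b i j).1))
      (fun i s t => abs_lossOnBag_sub_le hlip (hF₀ s.2) (hF₀ t.2) (b i))
    simp only [empiricalRademacher_eq_expect, ← Real.mul_iSup_of_nonneg hm0, ← Finset.mul_expect,
      ← Finset.mul_sum]
    calc _ ≤ 1 / (m : ℝ) * _ := mul_le_mul_of_nonneg_left hc hm0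
      _ = _ := by ring
  have hswap : 𝔼 σ : Fin m → ℤˣ, ∫ b,
      (⨆ t : F₀, 1 / (m : ℝ) * ∑ i, ((σ i : ℤ) : ℝ) * lossOnBag l t (b i)) ∂P =
      ∫ b, 𝔼 σ : Fin m → ℤˣ,
        (⨆ t : F₀, 1 / (m : ℝ) * ∑ i, ((σ i : ℤ) : ℝ) * lossOnBag l t (b i)) ∂P := by
    simp only [Fintype.expect_eq_sum_div_card]
    rw [integral_div, integral_finsetSum _ fun σ _ => hlossint σ]
  have hexpint : Integrable (fun b : Fin m → LabeledBag k X => 𝔼 σ : Fin m → ℤˣ,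
      (⨆ t : F₀, 1 / (m : ℝ) * ∑ i, ((σ i : ℤ) : ℝ) * lossOnBag l t (b i))) P := by
    simp only [Fintype.expect_eq_sum_div_card]
    exact (integrable_finsetSum _ fun σ _ => hlossint σ).div_const _
  rw [hswap]
  calc _ ≤ ∫ b, 9 / 5 * ρ * ∑ j, empiricalRademacher F₀ (fun i => (b i j).1) ∂P :=
        integral_mono hexpint ((integrable_finsetSum _ fun j _ => hradint j).const_mul _) hpt
    _ = _ := by
        rw [integral_const_mul, integral_finsetSum _ fun j _ => hradint j]
        simp only [hrad]

/-- With high probability, all the deviations between true and empirical mean losses are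
controlled by the Rademacher complexities, relative to a fixed classifier. -/
lemma exists_deviation_bound (Q : Measure (LabeledBag k X)) [IsProbabilityMeasure Q]
    (hF_meas : ∀ f ∈ F, Measurable f) (hF_unit : ∀ f ∈ F, ∀ x, f x ∈ Set.Icc (0 : ℝ) 1)
    (hF_sep : PointwiseSeparable F) (hl : l = countLoss k ∨ l = countLikelihoodLoss k)
    (hρ : 0 ≤ ρ) (hM : 0 < M) (hlip : LossLipschitz l F ρ) (hbdd : LossBounded l F M)
    {f₀ : X → ℝ} (hf₀ : f₀ ∈ F) {m : ℕ} (hm : 1 ≤ m) {δ : ℝ} (hδ : 0 < δ) (hδ1 : δ < 1) :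
    ∃ A : Set (Fin m → LabeledBag k X), MeasurableSet A ∧
      Measure.pi (fun _ => Q) A ≤ ENNReal.ofReal δ ∧ ∀ b ∉ A, ∀ f ∈ F,
        (∫ y, lossOnBag l f y ∂Q - 1 / (m : ℝ) * ∑ i, lossOnBag l f (b i)) -
          (∫ y, lossOnBag l f₀ y ∂Q - 1 / (m : ℝ) * ∑ i, lossOnBag l f₀ (b i)) ≤
        4 * √2 * ρ * ∑ j, rademacher F (instanceLaw Q j) m
          + 4 * M * √(Real.log (2 / δ) / (2 * m)) := by
  obtain ⟨F₀, hF₀, hcount, hdense⟩ := hF_sep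
  have : Countable F₀ := hcount.to_subtype
  have hne : F.Nonempty := ⟨f₀, hf₀⟩
  have hne₀ : Nonempty F₀ := by
    obtain ⟨u, hu, -⟩ := hdense f₀ hf₀
    exact ⟨⟨u 0, hu 0⟩⟩
  have hm0 : (0 : ℝ) < m := by exact_mod_cast hm
  set P : Measure (Fin m → LabeledBag k X) := Measure.pi fun _ => Q with hP
  set dev : (X → ℝ) → (Fin m → LabeledBag k X) → ℝ := fun f b =>
    ∫ y, lossOnBag l f y ∂Q - 1 / (m : ℝ) * ∑ i, lossOnBag l f (b i) with hdev
  have hLm : ∀ f ∈ F, Measurable (lossOnBag l f) := fun f hf => measurable_lossOnBag hl (hF_meas f hf)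
  have hLb : ∀ f ∈ F, IsBoundedFun (lossOnBag l f) := fun f hf => ⟨M, abs_lossOnBag_le hbdd hf⟩
  have hdevm : ∀ f ∈ F, Measurable (dev f) := fun f hf => by
    have := hLm f hf
    fun_prop
  have hdevb : ∀ {A : Set (X → ℝ)}, A ⊆ F →
      IsBoundedFun fun p : A × (Fin m → LabeledBag k X) => dev p.1 p.2 := fun {A} hA => by
    refine IsBoundedFun.sub ⟨M, fun p => abs_integral_le_of_abs_le Q
      (abs_lossOnBag_le hbdd (hA p.1.2))⟩ ?_
    simpa using isBoundedFun_signed_mean (φ := fun (t : A) => lossOnBag l (t : X → ℝ))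
      (isBoundedFun_lossOnBag hA hbdd) (m := m) fun _ => 1
  have hdev_update : ∀ f ∈ F, ∀ b i y, |dev f (Function.update b i y) - dev f b| ≤ 2 * M / m :=
    fun f hf b i y => by
      have h1 := sum_update_sub_sum (lossOnBag l f) b i y
      have h2 : dev f (Function.update b i y) - dev f b =
          1 / (m : ℝ) * (lossOnBag l f (b i) - lossOnBag l f y) := by
        simp only [hdev]
        linear_combination (-(1 / (m : ℝ))) * h1
      rw [h2, abs_mul, abs_of_pos (by positivity : (0 : ℝ) < 1 / m), one_div_mul_eq_div]
      gcongr
      have a1 := abs_le.1 (abs_lossOnBag_le hbdd hf (b i))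
      have a2 := abs_le.1 (abs_lossOnBag_le hbdd hf y)
      exact abs_le.2 ⟨by linarith, by linarith⟩
  set U : (Fin m → LabeledBag k X) → ℝ := fun b => ⨆ t : F₀, dev t b with hU
  have hUm : Measurable U := Measurable.iSup fun t => hdevm t (hF₀ t.2)
  have hUb : IsBoundedFun U := isBoundedFun_iSup (hdevb hF₀)
  have hdev0b : IsBoundedFun (dev f₀) := (hdevb subset_rfl).comp fun b => (⟨f₀, hf₀⟩, b)
  have hle : ∀ b, ∀ f ∈ F, dev f b ≤ U b := fun b f hf => by
    refine le_iSup_of_pointwise_limit (G := fun f => dev f b) hdense (fun f hf u hu hlim => ?_)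
      ((hdevb hF₀).comp fun t => (t, b)) hf
    have hlimL := tendsto_lossOnBag hlip hf (fun n => hF₀ (hu n)) hlim
    refine Tendsto.sub ?_ ((tendsto_finsetSum _ fun i _ => hlimL (b i)).const_mul _)
    exact tendsto_integral_of_dominated_convergence (fun _ => M)
      (fun n => (hLm _ (hF₀ (hu n))).aestronglyMeasurable) (integrable_const M)
      (fun n => ae_of_all _ (abs_lossOnBag_le hbdd (hF₀ (hu n)))) (ae_of_all _ hlimL)
  -- Subtracting the deviation of `f₀` inside the random variable lets a single one-sided tail
  -- suffice. It costs nothing in mean and adds `2M/m` to the bounded differences.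
  set g : (Fin m → LabeledBag k X) → ℝ := fun b => U b - dev f₀ b with hg
  have hgm : Measurable g := hUm.sub (hdevm f₀ hf₀)
  have hgb : IsBoundedFun g := hUb.sub hdev0b
  have hgc : ∀ (i : Fin m) b y, g (Function.update b i y) - g b ≤ 4 * M / m := fun i b y => by
    have h1 : U (Function.update b i y) ≤ U b + 2 * M / m := ciSup_le fun t => by
      have := (abs_le.1 (hdev_update t (hF₀ t.2) b i y)).2
      have := hle b t (hF₀ t.2)
      linarith
    have h2 := (abs_le.1 (hdev_update f₀ hf₀ b i y)).1
    have h3 : 4 * M / m = 2 * M / m + 2 * M / m := by ring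
    simp only [hg]
    linarith
  have hEdev0 : ∫ b, dev f₀ b ∂P = 0 := by
    have hi : Integrable (fun b : Fin m → LabeledBag k X =>
        1 / (m : ℝ) * ∑ i, lossOnBag l f₀ (b i)) P := by
      have := (integrable_const (∫ y, lossOnBag l f₀ y ∂Q)).sub
        (hdev0b.integrable (Q := P) (hdevm f₀ hf₀))
      refine this.congr (ae_of_all _ fun b => ?_)
      simp [hdev]
    simp only [hdev]
    rw [integral_sub (integrable_const _) hi,
      integral_mean_pi Q hm ((hLb f₀ hf₀).integrable (hLm f₀ hf₀))]
    simp
  have hrad0 : 0 ≤ ρ * ∑ j, rademacher F (instanceLaw Q j) m :=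
    mul_nonneg hρ (Finset.sum_nonneg fun j _ => rademacher_nonneg hne hF_unit _ m)
  have hEg : ∫ b, g b ∂P ≤ 4 * √2 * ρ * ∑ j, rademacher F (instanceLaw Q j) m := by
    rw [hg, integral_sub (hUb.integrable hUm) (hdev0b.integrable (hdevm f₀ hf₀)), hEdev0, sub_zero]
    have h1 := integral_iSup_deviation_le Q (φ := fun (t : F₀) => lossOnBag l (t : X → ℝ))
      (fun t => hLm t (hF₀ t.2)) (isBoundedFun_lossOnBag hF₀ hbdd) hm
    have h2 := expect_integral_iSup_loss_le Q hF_meas hF_unit hF₀ hne hdense hl hρ hlip hbdd m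
    -- Already `√2 ≥ 1` gives `2 * (9/5) ≤ 4√2`.
    have h3 : (1 : ℝ) ≤ √2 := Real.one_le_sqrt.2 (by norm_num)
    refine h1.trans ?_
    nlinarith
  have hlog : 0 ≤ Real.log (2 / δ) := Real.log_nonneg (by rw [le_div_iff₀ hδ]; linarith)
  set s : ℝ := 4 * M * √(Real.log (2 / δ) / (2 * m)) with hs
  have hs0 : 0 ≤ s := by positivity
  refine ⟨{b | s ≤ g b - ∫ a, g a ∂P}, measurableSet_le measurable_const (hgm.sub_const _), ?_,
    fun b hb f hf => ?_⟩
  · have hmc := measure_sub_integral_ge_le_of_bounded_difference Q hgm hgb hgc hs0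
    -- The sum of squared differences is `16M²/m` and `s² = 8M² log(2/δ)/m`, so the exponent is
    -- `-log(2/δ)`. The tail `δ/2` is within the allowed `δ`.
    have hexp : Real.exp (-2 * s ^ 2 / ∑ _i : Fin m, (4 * M / m) ^ 2) = δ / 2 := by
      have h1 : s ^ 2 = 16 * M ^ 2 * (Real.log (2 / δ) / (2 * m)) := by
        rw [hs, mul_pow, Real.sq_sqrt (by positivity)]; ring
      have h2 : -2 * s ^ 2 / ∑ _i : Fin m, (4 * M / m) ^ 2 = - Real.log (2 / δ) := by
        rw [h1, Finset.sum_const, Finset.card_univ, Fintype.card_fin, nsmul_eq_mul]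
        field_simp
        ring
      rw [h2, ← Real.log_inv, Real.exp_log (by positivity), inv_div]
    rw [hexp] at hmc
    rw [← ofReal_measureReal]
    exact ENNReal.ofReal_le_ofReal (hmc.trans (by linarith))
  · simp only [Set.mem_ofPred_eq, not_le] at hb
    have := hle b f hf
    simp only [hg] at hb
    linarith

end Deviation

/-! ### Excess risk of the empirical minimizer -/

variable {X : Type*} [MeasurableSpace X] {k : ℕ} {l : BagLoss k} {F : Set (X → ℝ)} {ρ M : ℝ}

/-- The choice of `fhat` need not be measurable: the bad event is only included in the preimage of
the measurable set `A`, and monotonicity of the outer measure suffices. -/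
lemma measure_excess_risk_gt_le (hk : 1 ≤ k) (Q : Measure (LabeledBag k X))
    [IsProbabilityMeasure Q] (hF_meas : ∀ f ∈ F, Measurable f)
    (hF_unit : ∀ f ∈ F, ∀ x, f x ∈ Set.Icc (0 : ℝ) 1) (hF_sep : PointwiseSeparable F)
    (hl : l = countLoss k ∨ l = countLikelihoodLoss k) (hρ : 0 ≤ ρ)
    (hlip : LossLipschitz l F ρ) (hbdd : LossBounded l F M)
    {Ω : Type*} [MeasurableSpace Ω] (μ : Measure Ω) [IsProbabilityMeasure μ]
    {B : ℕ → Ω → LabeledBag k X} (hB_meas : ∀ i, Measurable (B i))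
    (hB_law : ∀ i, μ.map (B i) = Q) (hB_indep : iIndepFun B μ) {m : ℕ} {fhat : Ω → X → ℝ}
    (hfhat : ∀ ω, IsMinimizer (empiricalRisk l m fun i => B i ω) F (fhat ω))
    {f₀ : X → ℝ} (hf₀ : f₀ ∈ F) (hm : 1 ≤ m) {δ : ℝ} (hδ : 0 < δ) (hδ1 : δ < 1) :
    μ {ω | 1 / ((k : ℝ) * (k + 1)) *
          (4 * √2 * ρ * ∑ j, rademacher F (instanceLaw Q j) m
            + 4 * M * √(Real.log (2 / δ) / (2 * m)))
        < risk l Q (fhat ω) - risk l Q f₀} ≤ ENNReal.ofReal δ := by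
  have hk0 : (0 : ℝ) < k := by exact_mod_cast hk
  have hK : 0 < 1 / ((k : ℝ) * (k + 1)) := by positivity
  have hM : 0 ≤ M := by
    obtain ⟨b⟩ := nonempty_of_isProbabilityMeasure Q
    exact (abs_nonneg _).trans (abs_lossOnBag_le hbdd hf₀ b)
  -- For `M = 0` the McDiarmid exponent degenerates, but then every loss is zero and the bad event
  -- is empty.
  rcases hM.eq_or_lt with rfl | hM
  · have hzero : ∀ f ∈ F, risk l Q f = 0 := fun f hf => by
      have : ∀ b, lossOnBag l f b = 0 := fun b =>
        abs_eq_zero.1 (le_antisymm (abs_lossOnBag_le hbdd hf b) (abs_nonneg _))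
      simp [risk, this]
    have hrad0 : 0 ≤ ∑ j, rademacher F (instanceLaw Q j) m :=
      Finset.sum_nonneg fun j _ => rademacher_nonneg ⟨f₀, hf₀⟩ hF_unit _ m
    refine (measure_mono_null (fun ω hω => ?_) measure_empty).le.trans zero_le
    simp only [Set.mem_ofPred_eq, hzero _ (hfhat ω).1, hzero _ hf₀, sub_zero, mul_zero, zero_mul,
      add_zero] at hω
    exact absurd hω (not_lt.2 (by positivity))
  · obtain ⟨A, hA, hPA, hdev⟩ :=
      exists_deviation_bound Q hF_meas hF_unit hF_sep hl hρ hM hlip hbdd hf₀ hm hδ hδ1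
    have hBm : Measurable fun ω (i : Fin m) => B i ω :=
      measurable_pi_iff.2 fun i => hB_meas i
    calc μ _ ≤ μ ((fun ω (i : Fin m) => B i ω) ⁻¹' A) := by
          refine measure_mono fun ω hω => ?_
          by_contra hωA
          have h1 := hdev _ hωA _ (hfhat ω).1
          have h2 := (hfhat ω).2 f₀ hf₀
          simp only [empiricalRisk, Finset.sum_range] at h2
          have h3 := le_of_mul_le_mul_left h2 hK
          have h4 : 1 / ((k : ℝ) * (k + 1)) *
              (∫ b, lossOnBag l (fhat ω) b ∂Q - ∫ b, lossOnBag l f₀ b ∂Q) ≤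
              1 / ((k : ℝ) * (k + 1)) * (4 * √2 * ρ * ∑ j, rademacher F (instanceLaw Q j) m
                + 4 * M * √(Real.log (2 / δ) / (2 * m))) :=
            mul_le_mul_of_nonneg_left (by linarith) hK.le
          simp only [Set.mem_ofPred_eq, risk, ← mul_sub] at hω
          exact absurd hω (not_lt.2 h4)
      _ = Measure.pi (fun _ => Q) A := by
          rw [← map_initial_segment_eq_pi hB_meas hB_law hB_indep m, Measure.map_apply hBm hA]
      _ ≤ _ := hPA

/-! ### From confidence bounds to almost sure convergence -/

lemma tendsto_log_two_mul_sq_div :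
    Tendsto (fun m : ℕ => Real.log (2 / (1 / ((m : ℝ) + 1) ^ 2)) / (2 * m)) atTop (𝓝 0) := by
  have h1 : Tendsto (fun m : ℕ => Real.log ((m : ℝ) + 1) / ((m : ℝ) + 1)) atTop (𝓝 0) :=
    (Real.isLittleO_log_id_atTop.tendsto_div_nhds_zero).comp
      (tendsto_atTop_add_const_right _ 1 tendsto_natCast_atTop_atTop)
  have h2 : Tendsto (fun m : ℕ => (m : ℝ)⁻¹) atTop (𝓝 0) := tendsto_inv_atTop_nhds_zero_nat
  have h3 : Tendsto (fun m : ℕ => Real.log 2 / 2 * (m : ℝ)⁻¹ +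
      Real.log ((m : ℝ) + 1) / ((m : ℝ) + 1) * (1 + (m : ℝ)⁻¹)) atTop (𝓝 0) := by
    simpa using (h2.const_mul (Real.log 2 / 2)).add (h1.mul (h2.const_add 1))
  refine h3.congr' ?_
  filter_upwards [eventually_ge_atTop 1] with m hm
  have hm0 : (0 : ℝ) < m := by exact_mod_cast hm
  rw [div_div_eq_mul_div, div_one, Real.log_mul (by norm_num) (by positivity), Real.log_pow]
  field_simp
  push_cast
  ring

/-- A confidence level that is summable gives almost sure convergence of the excess risk. -/
lemma ae_tendsto_zero_of_measure_gt_le {Ω : Type*} [MeasurableSpace Ω] {μ : Measure Ω}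
    {e : ℕ → Ω → ℝ} {a : ℕ → ℝ} (he : ∀ m ω, 0 ≤ e m ω) (ha : Tendsto a atTop (𝓝 0))
    (hμ : ∀ m : ℕ, 1 ≤ m → μ {ω | a m < e m ω} ≤ ENNReal.ofReal (1 / ((m : ℝ) + 1) ^ 2)) :
    ∀ᵐ ω ∂μ, Tendsto (fun m => e m ω) atTop (𝓝 0) := by
  have hsum : Summable fun m : ℕ => 1 / (((m + 1 : ℕ) : ℝ) + 1) ^ 2 := by
    have := (summable_nat_add_iff 2).2 (Real.summable_one_div_nat_pow.2 one_lt_two)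
    refine this.congr fun m => ?_
    push_cast
    ring
  -- Borel–Cantelli runs over `m + 1`, since the tail bound is assumed only from index `1` on.
  have hfin : ∑' m : ℕ, μ {ω | a (m + 1) < e (m + 1) ω} ≠ ⊤ :=
    ne_top_of_le_ne_top hsum.tsum_ofReal_ne_top
      (ENNReal.tsum_le_tsum fun m => hμ (m + 1) (by omega))
  filter_upwards [ae_eventually_notMem hfin] with ω hω
  rw [← tendsto_add_atTop_iff_nat 1]
  refine tendsto_of_tendsto_of_tendsto_of_le_of_le' tendsto_const_nhds
    ((tendsto_add_atTop_iff_nat 1).2 ha) (Eventually.of_forall fun m => he _ ω) ?_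
  filter_upwards [hω] with m h
  simpa using h

end

end CountLLP

theorem proposition3 {X : Type*} [MeasurableSpace X] {k : ℕ} (hk : 1 ≤ k)
    (Q : Measure (CountLLP.LabeledBag k X)) [IsProbabilityMeasure Q]
    (F : Set (X → ℝ)) (hF_meas : ∀ f ∈ F, Measurable f)
    (hF_unit : ∀ f ∈ F, ∀ x, f x ∈ Set.Icc (0 : ℝ) 1)
    (hF_sep : CountLLP.PointwiseSeparable F)
    (l : CountLLP.BagLoss k)
    (hl : l = CountLLP.countLoss k ∨ l = CountLLP.countLikelihoodLoss k)
    (ρ M : ℝ) (hρ : 0 ≤ ρ)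
    (hlip : CountLLP.LossLipschitz l F ρ) (hbdd : CountLLP.LossBounded l F M)
    {Ω : Type*} [MeasurableSpace Ω] (μ : Measure Ω) [IsProbabilityMeasure μ]
    (B : ℕ → Ω → CountLLP.LabeledBag k X) (hB_meas : ∀ i, Measurable (B i))
    (hB_law : ∀ i, μ.map (B i) = Q) (hB_indep : iIndepFun B μ)
    (fhat : ℕ → Ω → X → ℝ)
    (hfhat : ∀ m ω,
      CountLLP.IsMinimizer (CountLLP.empiricalRisk l m fun i => B i ω) F (fhat m ω))
    (fstar : X → ℝ) (hfstar : CountLLP.IsMinimizer (CountLLP.risk l Q) F fstar) :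
    (∀ m : ℕ, 1 ≤ m → ∀ δ : ℝ, 0 < δ → δ < 1 →
      μ {ω | 1 / ((k : ℝ) * (k + 1)) *
            (4 * √2 * ρ * ∑ j, CountLLP.rademacher F (CountLLP.instanceLaw Q j) m
              + 4 * M * √(Real.log (2 / δ) / (2 * m)))
          < CountLLP.risk l Q (fhat m ω) - CountLLP.risk l Q fstar} ≤ ENNReal.ofReal δ) ∧
    ((∀ j, Tendsto (CountLLP.rademacher F (CountLLP.instanceLaw Q j)) atTop (𝓝 0)) →
      ∀ᵐ ω ∂μ, Tendsto (fun m => CountLLP.risk l Q (fhat m ω)) atTop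
        (𝓝 (CountLLP.risk l Q fstar))) ∧
    (∀ C : ℝ,
      (∀ m : ℕ, 1 ≤ m → ∀ j, CountLLP.rademacher F (CountLLP.instanceLaw Q j) m ≤ C / √m) →
      ∀ m : ℕ, 1 ≤ m → ∀ δ : ℝ, 0 < δ → δ < 1 →
        μ {ω | 1 / ((k : ℝ) * (k + 1)) *
              (4 * √2 * ρ * k * C + 4 * M * √(Real.log (2 / δ) / 2)) / √m
            < CountLLP.risk l Q (fhat m ω) - CountLLP.risk l Q fstar} ≤ ENNReal.ofReal δ) := by
  have hbound : ∀ m : ℕ, 1 ≤ m → ∀ δ : ℝ, 0 < δ → δ < 1 → _ := fun m hm δ hδ hδ1 =>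
    CountLLP.measure_excess_risk_gt_le hk Q hF_meas hF_unit hF_sep hl hρ hlip hbdd μ hB_meas hB_law
      hB_indep (hfhat m) hfstar.1 hm hδ hδ1
  refine ⟨hbound, fun hrad => ?_, fun C hC m hm δ hδ hδ1 => ?_⟩
  -- The level `δ = 1/(m+1)²` is summable, yet `log(2/δ)` is still negligible against `m`.
  · have ha : Tendsto (fun m : ℕ => 1 / ((k : ℝ) * (k + 1)) *
        (4 * √2 * ρ * ∑ j, CountLLP.rademacher F (CountLLP.instanceLaw Q j) m
          + 4 * M * √(Real.log (2 / (1 / ((m : ℝ) + 1) ^ 2)) / (2 * m)))) atTop (𝓝 0) := by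
      have h1 := tendsto_finsetSum Finset.univ fun j _ => hrad j
      have h2 := CountLLP.tendsto_log_two_mul_sq_div.sqrt
      simpa using ((h1.const_mul (4 * √2 * ρ)).add (h2.const_mul (4 * M))).const_mul
        (1 / ((k : ℝ) * (k + 1)))
    have hae := CountLLP.ae_tendsto_zero_of_measure_gt_le (μ := μ)
      (e := fun m ω => CountLLP.risk l Q (fhat m ω) - CountLLP.risk l Q fstar)
      -- Minimality of `fstar` gives the lower bound in the squeeze.
      (fun m ω => sub_nonneg.2 (hfstar.2 _ (hfhat m ω).1)) ha fun m hm =>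
        hbound m hm _ (by positivity) (by
          have : (1 : ℝ) ≤ m := by exact_mod_cast hm
          rw [div_lt_one (by positivity)]
          nlinarith)
    filter_upwards [hae] with ω hω
    simpa using hω.add_const (CountLLP.risk l Q fstar)
  · refine (measure_mono fun ω hω => ?_).trans (hbound m hm δ hδ hδ1)
    simp only [Set.mem_ofPred_eq] at hω ⊢
    -- Under the assumed rate, the threshold of the first claim is at most the new one, so the new
    -- bad event is contained in the old one.
    refine lt_of_le_of_lt ?_ hω
    have hm0 : (0 : ℝ) < m := by exact_mod_cast hm
    have hsum : ∑ j, CountLLP.rademacher F (CountLLP.instanceLaw Q j) m ≤ k * (C / √m) := by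
      refine (Finset.sum_le_sum fun j _ => hC m hm j).trans_eq ?_
      simp
    have hsqrt : √(Real.log (2 / δ) / (2 * m)) = √(Real.log (2 / δ) / 2) / √m := by
      rw [← Real.sqrt_div' _ hm0.le, div_div]
    rw [mul_div_assoc, hsqrt]
    refine mul_le_mul_of_nonneg_left ?_ (by positivity)
    calc _ ≤ 4 * √2 * ρ * (k * (C / √m)) + 4 * M * (√(Real.log (2 / δ) / 2) / √m) := by gcongr
      _ = _ := by ring
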